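/- **Setting.** Let $T>0$, let $\boldsymbol w$ be a standard $d$-dimensional Wiener process, and consider the forward SDE $$d x_t = F(x_t,t)\,dt + G(t)\,d\boldsymbol w_t,\qquad t\in[0,T],$$ with deterministic drift $F$ and deterministic scalar $G\in L^2(0,T)$. Assume that its solution is uniquely determined by the initial point and the trajectory of the noise, $x_t=\mathcal F_t(x_0,\boldsymbol w)$, where $\mathcal F$ is jointly measurable. For an initial law $\mu$ on $\mathbb R^d$ (independent of $\boldsymbol w$) let $\mu^{(t)}$ be the law of $x_t$. For a measurable weight $w$ with $w(t)>0$ on $(0,T]$, define $$\mathcal D_{IKL}(\mu,\nu)=\int_0^T w(t)\,\mathrm{KL}(\mu^{(t)}\,\|\,\nu^{(t)})\,dt\in[0,\infty].$$ Let $\Theta\subset\mathbb R^m$ be open, let $z\sim p_z$ be independent of $\boldsymbol w$, let $g_\theta$, $\theta\in\Theta$, be a (measurable) generator with values in $\mathbb R^d$, let $p_\theta^{(0)}$ be the law of $x_0=g_\theta(z)$, and let $x_t=x_t(\theta)=\mathcal F_t(g_\theta(z),\boldsymbol w)$. Let $q^{(0)}$ be a probability measure on $\mathbb R^d$. **Assumptions.**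 1. For $\theta\in\Theta$ and $t\in(0,T]$ the laws $p^{(t)}_\theta$ and $q^{(t)}$ have positive Lebesgue densities (denoted by the same symbols, and measurable in $(t,x)$), such that $(\theta,x)\mapsto p^{(t)}_\theta(x)$ is differentiable on $\Theta\times\mathbb R^d$ and $q^{(t)}$ is differentiable. The scores are $s_{p_\theta^{(t)}}=\nabla_x\log p_\theta^{(t)}$ and $s_{q^{(t)}}=\nabla_x\log q^{(t)}$. 2. For almost all $(t,z,\boldsymbol w)$ the map $\theta\mapsto x_t(\theta)$ is differentiable on $\Theta$; $\partial x_t/\partial\theta$ denotes its Jacobian matrix. 3. $\mathcal D_{IKL}(p^{(0)}_\theta,q^{(0)})<\infty$ for all $\theta\in\Theta$. 4. For every $\theta_0\in\Theta$ and almost every $t\in(0,T)$ there are a neighbourhood $U$ of $\theta_0$ and $h\in L^1(\mathbb R^d)$ with $\|\partial_\theta p_\theta^{(t)}(x)\|\le h(x)$ for almost every $x$ and all $\theta\in U$. 5. For every $\theta_0\in\Theta$ there are a neighbourhood $U$ of $\theta_0$ and a function $H(t,z,\boldsymbol w)$ such that $w(t)H$ is integrable on $(0,T)\times(\text{law of }(z,\boldsymbol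 w))$ and, for almost every $(t,z,\boldsymbol w)$ and all $\theta\in U$, $$\Big\|\frac{\partial}{\partial\theta}\Big[\log\frac{p_\theta^{(t)}(x_t(\theta))}{q^{(t)}(x_t(\theta))}\Big]\Big\|\le H(t,z,\boldsymbol w),$$ where the derivative is the total derivative in $\theta$. **Theorem.** Under these assumptions $\theta\mapsto\mathcal D_{IKL}(p^{(0)}_\theta,q^{(0)})$ is differentiable on $\Theta$, and for every $\theta\in\Theta$ $$\nabla_\theta\,\mathcal D_{IKL}(p^{(0)}_\theta,q^{(0)})=\int_0^T w(t)\,\mathbb E_{z,\boldsymbol w}\Big[\Big(\frac{\partial x_t}{\partial\theta}\Big)^{\!\top}\big(s_{p_\theta^{(t)}}(x_t)-s_{q^{(t)}}(x_t)\big)\Big]dt,$$ where the expectation converges absolutely for almost every $t$ and the integral over $t$ converges absolutely. -/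

import Mathlib

open MeasureTheory ProbabilityTheory Set Filter
open scoped NNReal ENNReal Topology

noncomputable section

/-- A standard `d`-dimensional Wiener process: the coordinate processes are independent
real Brownian motions. -/
structure IsWienerProcess {d : ℕ} {Ω : Type*} [MeasurableSpace Ω]
    (W : ℝ≥0 → Ω → EuclideanSpace ℝ (Fin d)) (P : Measure Ω) : Prop where
  brownian : ∀ i, IsBrownianReal (fun t ω => W t ω i) P
  indep : iIndepFun (fun (i : Fin d) (ω : Ω) (t : ℝ≥0) => W t ω i) P

/-- A step function `∑ i < n, c i • 1_(a i, a (i + 1)]` on the half line, with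
`a 0 ≤ a 1 ≤ a 2 ≤ …`. -/
structure StepFun where
  n : ℕ
  a : ℕ → ℝ≥0
  mono : Monotone a
  c : ℕ → ℝ

/-- The step function as a function of time. -/
def StepFun.toFun (φ : StepFun) (s : ℝ) : ℝ :=
  ∑ i ∈ Finset.range φ.n, (Ioc (φ.a i : ℝ) (φ.a (i + 1))).indicator (fun _ => φ.c i) s

/-- The elementary stochastic integral `∫ φ dW` of a step function. -/
def StepFun.integral {d : ℕ} {Ω : Type*} (φ : StepFun)
    (W : ℝ≥0 → Ω → EuclideanSpace ℝ (Fin d)) (ω : Ω) : EuclideanSpace ℝ (Fin d) :=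
  ∑ i ∈ Finset.range φ.n, φ.c i • (W (φ.a (i + 1)) ω - W (φ.a i) ω)

/-- `N t = ∫_0^t G(s) dW_s` for `t ∈ [0, T]`: the stochastic integral of a deterministic scalar
function `G ∈ L²(0, T)`, in a version with continuous paths. Its value at time `t` is the
`L²(P)`-limit of elementary integrals of step functions on `(0, t]` that converge to `G`
in `L²(0, t)`. -/
structure IsWienerIntegral {d : ℕ} {Ω : Type*} [MeasurableSpace Ω] (G : ℝ → ℝ)
    (W : ℝ≥0 → Ω → EuclideanSpace ℝ (Fin d)) (P : Measure Ω) (T : ℝ)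
    (N : ℝ → Ω → EuclideanSpace ℝ (Fin d)) : Prop where
  memLp : MemLp G 2 (volume.restrict (Ioc 0 T))
  cont : ∀ᵐ ω ∂P, ContinuousOn (fun t => N t ω) (Icc 0 T)
  approx : ∀ t ∈ Icc (0 : ℝ) T, ∃ φ : ℕ → StepFun,
    (∀ k, ((φ k).a (φ k).n : ℝ) ≤ t) ∧
    Tendsto (fun k => eLpNorm (fun s => (φ k).toFun s - G s) 2 (volume.restrict (Ioc 0 t)))
      atTop (𝓝 0) ∧
    Tendsto (fun k => eLpNorm (fun ω => (φ k).integral W ω - N t ω) 2 P) atTop (𝓝 0)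

/-- On `[0, τ]`, the path `x` is continuous and solves the integral equation
`x t = x₀ + ∫_0^t F(x_s, s) ds + n t`. -/
def SolvesOn {d : ℕ} (F : EuclideanSpace ℝ (Fin d) → ℝ → EuclideanSpace ℝ (Fin d))
    (n : ℝ → EuclideanSpace ℝ (Fin d)) (x₀ : EuclideanSpace ℝ (Fin d)) (τ : ℝ)
    (x : ℝ → EuclideanSpace ℝ (Fin d)) : Prop :=
  ContinuousOn x (Icc 0 τ) ∧
  IntervalIntegrable (fun s => F (x s) s) volume 0 τ ∧
  ∀ t ∈ Icc 0 τ, x t = x₀ + (∫ s in (0 : ℝ)..t, F (x s) s) + n t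

/-- `X t x₀ ω` is the solution at time `t ∈ [0, T]` of the stochastic differential equation
`dx_t = F(x_t, t) dt + G(t) dW_t` with initial value `x₀`. The noise is additive, so that the
equation is solved along every trajectory (outside of a null set); the solution is uniquely
determined by the initial point and the trajectory of the noise. -/
structure IsSDEFlow {d : ℕ} {Ω : Type*} [MeasurableSpace Ω]
    (F : EuclideanSpace ℝ (Fin d) → ℝ → EuclideanSpace ℝ (Fin d)) (G : ℝ → ℝ)
    (W : ℝ≥0 → Ω → EuclideanSpace ℝ (Fin d)) (P : Measure Ω) (T : ℝ)
    (X : ℝ → EuclideanSpace ℝ (Fin d) → Ω → EuclideanSpace ℝ (Fin d)) : Prop where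
  measurable : Measurable
    (fun a : ℝ × EuclideanSpace ℝ (Fin d) × Ω => X a.1 a.2.1 a.2.2)
  solves : ∃ N : ℝ → Ω → EuclideanSpace ℝ (Fin d), IsWienerIntegral G W P T N ∧
    ∀ᵐ ω ∂P, ∀ x₀,
      SolvesOn F (fun t => N t ω) x₀ T (fun t => X t x₀ ω) ∧
      ∀ τ ∈ Icc (0 : ℝ) T, ∀ y, SolvesOn F (fun t => N t ω) x₀ τ y →
        ∀ t ∈ Icc 0 τ, y t = X t x₀ ω

/-- The marginal law at time `t` of the diffusion with flow `X`, whose initial value has law `μ`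
and is independent of the noise. -/
def diffusedLaw {d : ℕ} {Ω : Type*} [MeasurableSpace Ω]
    (X : ℝ → EuclideanSpace ℝ (Fin d) → Ω → EuclideanSpace ℝ (Fin d)) (P : Measure Ω)
    (μ : Measure (EuclideanSpace ℝ (Fin d))) (t : ℝ) : Measure (EuclideanSpace ℝ (Fin d)) :=
  (μ.prod P).map (fun a => X t a.1 a.2)

/-- The integral Kullback-Leibler divergence `∫_0^T w(t) KL(p⁽ᵗ⁾, q⁽ᵗ⁾) dt ∈ [0, ∞]` between two
initial laws, along the diffusion with flow `X`. -/
def ikl {d : ℕ} {Ω : Type*} [MeasurableSpace Ω]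
    (X : ℝ → EuclideanSpace ℝ (Fin d) → Ω → EuclideanSpace ℝ (Fin d)) (P : Measure Ω)
    (w : ℝ → ℝ) (T : ℝ) (μ ν : Measure (EuclideanSpace ℝ (Fin d))) : ℝ≥0∞ :=
  ∫⁻ t in Ioc 0 T, ENNReal.ofReal (w t) *
    InformationTheory.klDiv (diffusedLaw X P μ t) (diffusedLaw X P ν t)

/-- `f` is a positive Lebesgue density of `μ`. -/
def IsPosDensity {d : ℕ} (μ : Measure (EuclideanSpace ℝ (Fin d)))
    (f : EuclideanSpace ℝ (Fin d) → ℝ) : Prop :=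
  (∀ x, 0 < f x) ∧ μ = volume.withDensity (fun x => ENNReal.ofReal (f x))

/-- The score function `∇ log f` of a density `f`. -/
def score {d : ℕ} (f : EuclideanSpace ℝ (Fin d) → ℝ) (x : EuclideanSpace ℝ (Fin d)) :
    EuclideanSpace ℝ (Fin d) :=
  gradient (fun y => Real.log (f y)) x

end

/-!
Write `L η = log (p η t x_t(η) / q t x_t(η))` for the log-density ratio along a sample
`x_t(η) = X t (g η z) ω`. Changing variables from the marginal law to the sample space turns the
divergence into `∫ w(t) E[L η] dt` (`toReal_ikl_map`), an integral against measures that do not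
depend on the parameter. It can be differentiated under the integral sign, with the bound `w H`
(`hasFDerivAt_integral_mul_integral`). The weight `w` is not assumed integrable, so `w L η` need
not be integrable on the product space, although the iterated integral converges; the difference
`w (L η - L θ)` is integrable by the mean value inequality, and this is the function to which
dominated differentiation applies.

By the chain rule (`hasFDerivAt_log_div`) the derivative of `L` at `θ` is the sum of
`(p θ)⁻¹ ∂_θ p` at the fixed point `x_t(θ)` and of the transposed Jacobian applied to the score
difference. For almost every `t` the former has mean `∫ ∂_θ p dx`, the derivative of the constant
total mass, which is `0` (`integral_inv_smul_fderiv_density`). What remains is the asserted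
gradient.
-/

/-! ### Differentiation under the integral sign -/

/-- The derivative is the limit of difference quotients along the vectors of a basis, so
measurability of `f η` for `η` near `θ` suffices. -/
theorem aestronglyMeasurable_fderiv_of_eventually {m : ℕ} {α : Type*} [MeasurableSpace α]
    {μ : Measure α} {f : EuclideanSpace ℝ (Fin m) → α → ℝ} {θ : EuclideanSpace ℝ (Fin m)}
    (hf : ∀ᶠ η in 𝓝 θ, AEStronglyMeasurable (f η) μ)
    (hd : ∀ᵐ a ∂μ, DifferentiableAt ℝ (fun η => f η a) θ) :
    AEStronglyMeasurable (fun a => fderiv ℝ (fun η => f η a) θ) μ := by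
  have hdir : ∀ v : EuclideanSpace ℝ (Fin m),
      AEStronglyMeasurable (fun a => fderiv ℝ (fun η => f η a) θ v) μ := by
    intro v
    have hlim : Tendsto (fun n : ℕ => θ + ((n : ℝ) + 1)⁻¹ • v) atTop (𝓝 θ) := by
      have h0 : Tendsto (fun n : ℕ => ((n : ℝ) + 1)⁻¹) atTop (𝓝 0) := by
        simpa using tendsto_one_div_add_atTop_nhds_zero_nat (𝕜 := ℝ)
      simpa using (h0.smul_const v).const_add θ
    obtain ⟨N, hN⟩ := eventually_atTop.1 (hlim.eventually hf)
    refine aestronglyMeasurable_of_tendsto_ae (u := (atTop : Filter ℕ))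
      (f := fun n a => ((((n + N : ℕ) : ℝ) + 1)) •
        (f (θ + (((n + N : ℕ) : ℝ) + 1)⁻¹ • v) a - f θ a)) ?_ ?_
    · intro n
      exact ((hN (n + N) (Nat.le_add_left _ _)).sub hf.self_of_nhds).const_smul
        (((n + N : ℕ) : ℝ) + 1)
    · filter_upwards [hd] with a ha
      have h1 : Tendsto (fun n : ℕ => ((n : ℝ) + 1)) atTop atTop :=
        tendsto_atTop_add_const_right _ _ tendsto_natCast_atTop_atTop
      have h2 := ha.hasFDerivAt.lim_real v
      exact (h2.comp h1).comp (tendsto_add_atTop_nat N)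
  have hsum : (fun a => fderiv ℝ (fun η => f η a) θ) = fun a => ∑ i : Fin m,
      (fderiv ℝ (fun η => f η a) θ (EuclideanSpace.single i 1)) •
        (EuclideanSpace.proj i : EuclideanSpace ℝ (Fin m) →L[ℝ] ℝ) := by
    funext a
    ext v
    conv_lhs => rw [← (EuclideanSpace.basisFun (Fin m) ℝ).sum_repr v]
    simp [map_sum, mul_comm]
  rw [hsum]
  exact Finset.aestronglyMeasurable_fun_sum _ fun i _ => (hdir _).smul_const _

theorem integral_toDual {m : ℕ} {α : Type*} [MeasurableSpace α] {μ : Measure α}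
    {f : α → EuclideanSpace ℝ (Fin m)} (hf : Integrable f μ) :
    ∫ a, InnerProductSpace.toDual ℝ _ (f a) ∂μ = InnerProductSpace.toDual ℝ _ (∫ a, f a ∂μ) := by
  ext v
  rw [ContinuousLinearMap.integral_apply
    ((LinearIsometryEquiv.integrable_comp_iff (InnerProductSpace.toDual ℝ _)).2 hf)]
  simp only [InnerProductSpace.toDual_apply_apply]
  simp_rw [real_inner_comm v]
  exact integral_inner hf v

/-- Differentiation of an iterated integral whose integrand need not be integrable on the product
space. Only `w (L η - L θ)` is, by the mean value inequality; this difference is what is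
differentiated. -/
theorem hasFDerivAt_integral_mul_integral {m : ℕ} {α β : Type*} [MeasurableSpace α]
    [MeasurableSpace β] {κ : Measure α} {ρ : Measure β} [SFinite κ] [SFinite ρ]
    {L : EuclideanSpace ℝ (Fin m) → α × β → ℝ} {w : α → ℝ} {Θ : Set (EuclideanSpace ℝ (Fin m))}
    (hΘ : IsOpen Θ) {θ : EuclideanSpace ℝ (Fin m)} (hθ : θ ∈ Θ)
    (hw : Measurable w) (hw0 : ∀ᵐ t ∂κ, 0 < w t)
    (hL : ∀ η ∈ Θ, AEStronglyMeasurable (L η) (κ.prod ρ))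
    (hd : ∀ᵐ a ∂κ.prod ρ, DifferentiableOn ℝ (fun η => L η a) Θ)
    (hint : ∀ η ∈ Θ, ∀ᵐ t ∂κ, Integrable (fun b => L η (t, b)) ρ)
    (hint' : ∀ η ∈ Θ, Integrable (fun t => w t * ∫ b, L η (t, b) ∂ρ) κ)
    {U : Set (EuclideanSpace ℝ (Fin m))} (hU : U ∈ 𝓝 θ) {H : α × β → ℝ}
    (hH : Integrable (fun a => w a.1 * H a) (κ.prod ρ))
    (hbound : ∀ᵐ a ∂κ.prod ρ, ∀ η ∈ U, ‖fderiv ℝ (fun η => L η a) η‖ ≤ H a) :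
    Integrable (fun a => w a.1 • fderiv ℝ (fun η => L η a) θ) (κ.prod ρ) ∧
    HasFDerivAt (fun η => ∫ t, w t * ∫ b, L η (t, b) ∂ρ ∂κ)
      (∫ a, w a.1 • fderiv ℝ (fun η => L η a) θ ∂κ.prod ρ) θ := by
  obtain ⟨ε, hε, hball⟩ := Metric.mem_nhds_iff.1 (inter_mem hU (hΘ.mem_nhds hθ))
  have hw0' : ∀ᵐ a ∂κ.prod ρ, 0 < w a.1 := Measure.quasiMeasurePreserving_fst.ae hw0
  have hwm : AEStronglyMeasurable (fun a : α × β => w a.1) (κ.prod ρ) :=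
    (hw.comp measurable_fst).aestronglyMeasurable
  have hlip : ∀ᵐ a ∂κ.prod ρ, ∀ η ∈ Metric.ball θ ε,
      ‖w a.1 * (L η a - L θ a) - w a.1 * (L θ a - L θ a)‖ ≤ w a.1 * H a * ‖η - θ‖ := by
    filter_upwards [hw0', hd, hbound] with a hwa hda hba η hη
    have := (convex_ball θ ε).norm_image_sub_le_of_norm_fderiv_le (𝕜 := ℝ)
      (f := fun η => L η a) (fun x hx => hda.differentiableAt (hΘ.mem_nhds (hball hx).2))
      (fun x hx => hba x (hball hx).1) (Metric.mem_ball_self hε) hη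
    rw [sub_self, mul_zero, sub_zero, norm_mul, Real.norm_of_nonneg hwa.le, mul_assoc]
    exact mul_le_mul_of_nonneg_left this hwa.le
  obtain ⟨h1, h2⟩ := hasFDerivAt_integral_of_dominated_loc_of_lip' (𝕜 := ℝ) (μ := κ.prod ρ)
    (F := fun η a => w a.1 * (L η a - L θ a))
    (F' := fun a => w a.1 • fderiv ℝ (fun η => L η a) θ)
    (bound := fun a => w a.1 * H a) (Metric.ball_mem_nhds θ hε)
    (fun η hη => hwm.mul ((hL η (hball hη).2).sub (hL θ hθ)))
    (by simp)
    (hwm.smul (aestronglyMeasurable_fderiv_of_eventually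
      (by filter_upwards [hΘ.mem_nhds hθ] with η hη using hL η hη)
      (by filter_upwards [hd] with a ha using ha.differentiableAt (hΘ.mem_nhds hθ))))
    hlip hH
    (by
      filter_upwards [hd] with a ha
      simpa using ((ha.differentiableAt (hΘ.mem_nhds hθ)).hasFDerivAt.sub_const
        (L θ a)).const_mul (w a.1))
  refine ⟨h1, ?_⟩
  refine (h2.add_const (∫ t, w t * ∫ b, L θ (t, b) ∂ρ ∂κ)).congr_of_eventuallyEq ?_
  filter_upwards [Metric.ball_mem_nhds θ hε] with η hη
  have hηΘ := (hball hη).2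
  have hI : Integrable (fun a => w a.1 * (L η a - L θ a)) (κ.prod ρ) := by
    refine (hH.mul_const ‖η - θ‖).mono' (hwm.mul ((hL η hηΘ).sub (hL θ hθ))) ?_
    filter_upwards [hlip] with a ha
    simpa using ha η hη
  rw [integral_prod _ hI, ← sub_eq_iff_eq_add, ← integral_sub (hint' η hηΘ) (hint' θ hθ)]
  refine integral_congr_ae ?_
  filter_upwards [hint η hηΘ, hint θ hθ] with t h3 h4
  rw [integral_const_mul, integral_sub h3 h4, mul_sub]

/-! ### Divergence of measures with positive densities -/

section Density

variable {d : ℕ} {μ ν : Measure (EuclideanSpace ℝ (Fin d))}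
  {p q : EuclideanSpace ℝ (Fin d) → ℝ}

theorem IsPosDensity.eq_withDensity_div (hp : IsPosDensity μ p) (hq : IsPosDensity ν q)
    (hpm : Measurable p) (hqm : Measurable q) :
    μ = ν.withDensity fun x => ENNReal.ofReal (p x / q x) := by
  rw [hq.2, ← withDensity_mul (g := fun x => ENNReal.ofReal (p x / q x)) _ hqm.ennreal_ofReal
    (hpm.div hqm).ennreal_ofReal, hp.2]
  congr 1
  funext x
  rw [Pi.mul_apply, ← ENNReal.ofReal_mul (hq.1 x).le, mul_div_cancel₀ _ (hq.1 x).ne']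

theorem IsPosDensity.absolutelyContinuous (hp : IsPosDensity μ p) (hq : IsPosDensity ν q)
    (hpm : Measurable p) (hqm : Measurable q) : μ ≪ ν := by
  rw [hp.eq_withDensity_div hq hpm hqm]
  exact withDensity_absolutelyContinuous _ _

theorem IsPosDensity.rnDeriv_eq [SigmaFinite ν] (hp : IsPosDensity μ p) (hq : IsPosDensity ν q)
    (hpm : Measurable p) (hqm : Measurable q) :
    (fun x => (μ.rnDeriv ν x).toReal) =ᵐ[ν] fun x => p x / q x := by
  have h := Measure.rnDeriv_withDensity ν (hpm.div hqm).ennreal_ofReal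
  simp only [Pi.div_apply] at h
  rw [← hp.eq_withDensity_div hq hpm hqm] at h
  filter_upwards [h] with x hx
  rw [hx, ENNReal.toReal_ofReal (div_pos (hp.1 x) (hq.1 x)).le]

theorem IsPosDensity.llr_eq [SigmaFinite ν] (hp : IsPosDensity μ p) (hq : IsPosDensity ν q)
    (hpm : Measurable p) (hqm : Measurable q) :
    llr μ ν =ᵐ[μ] fun x => Real.log (p x / q x) := by
  filter_upwards [(hp.absolutelyContinuous hq hpm hqm).ae_le (hp.rnDeriv_eq hq hpm hqm)]
    with x hx
  rw [llr, hx]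

/-- In this form, with Lebesgue measure as reference, the divergence depends measurably on
parameters of the densities. -/
theorem IsPosDensity.klDiv_eq_lintegral [IsFiniteMeasure μ] [IsFiniteMeasure ν]
    (hp : IsPosDensity μ p) (hq : IsPosDensity ν q) (hpm : Measurable p) (hqm : Measurable q) :
    InformationTheory.klDiv μ ν = ∫⁻ x, ENNReal.ofReal (q x) *
      ENNReal.ofReal (InformationTheory.klFun (p x / q x)) := by
  rw [InformationTheory.klDiv_eq_lintegral_klFun_of_ac (hp.absolutelyContinuous hq hpm hqm)]
  rw [lintegral_congr_ae (g := fun x => ENNReal.ofReal (InformationTheory.klFun (p x / q x)))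
    (by filter_upwards [hp.rnDeriv_eq hq hpm hqm] with x hx; rw [hx])]
  conv_lhs => rw [hq.2]
  exact lintegral_withDensity_eq_lintegral_mul _ hqm.ennreal_ofReal
    (InformationTheory.measurable_klFun.comp (hpm.div hqm)).ennreal_ofReal

theorem IsPosDensity.integral_eq_one [IsProbabilityMeasure μ] (hp : IsPosDensity μ p)
    (hpm : Measurable p) : Integrable p ∧ ∫ x, p x = 1 := by
  have h1 : ∫⁻ x, ENNReal.ofReal (p x) = 1 := by
    have := measure_univ (μ := μ)
    rwa [hp.2, withDensity_apply _ MeasurableSet.univ, Measure.restrict_univ] at this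
  have h0 : 0 ≤ᵐ[volume] p := ae_of_all _ fun x => (hp.1 x).le
  refine ⟨⟨hpm.aestronglyMeasurable, ?_⟩, ?_⟩
  · rw [hasFiniteIntegral_iff_ofReal h0, h1]
    exact ENNReal.one_lt_top
  · rw [integral_eq_lintegral_of_nonneg_ae h0 hpm.aestronglyMeasurable, h1, ENNReal.toReal_one]

end Density

/-- The relative parameter derivative of a probability density has mean zero: its mean is the
derivative of the total mass. -/
theorem integral_inv_smul_fderiv_density {d m : ℕ} {Θ : Set (EuclideanSpace ℝ (Fin m))}
    (hΘ : IsOpen Θ) {θ : EuclideanSpace ℝ (Fin m)} (hθ : θ ∈ Θ)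
    {μ : EuclideanSpace ℝ (Fin m) → Measure (EuclideanSpace ℝ (Fin d))}
    (hμ : ∀ η ∈ Θ, IsProbabilityMeasure (μ η))
    {p : EuclideanSpace ℝ (Fin m) → EuclideanSpace ℝ (Fin d) → ℝ}
    (hpm : ∀ η ∈ Θ, Measurable (p η)) (hp : ∀ η ∈ Θ, IsPosDensity (μ η) (p η))
    (hd : ∀ x, DifferentiableOn ℝ (fun η => p η x) Θ)
    {U : Set (EuclideanSpace ℝ (Fin m))} (hU : U ∈ 𝓝 θ) {h : EuclideanSpace ℝ (Fin d) → ℝ}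
    (hh : Integrable h) (hb : ∀ᵐ x, ∀ η ∈ U, ‖fderiv ℝ (fun η => p η x) η‖ ≤ h x) :
    Integrable (fun x => (p θ x)⁻¹ • fderiv ℝ (fun η => p η x) θ) (μ θ) ∧
      ∫ x, (p θ x)⁻¹ • fderiv ℝ (fun η => p η x) θ ∂(μ θ) = 0 := by
  have hone : ∀ η ∈ Θ, Integrable (p η) ∧ ∫ x, p η x = 1 := fun η hη =>
    have := hμ η hη
    (hp η hη).integral_eq_one (hpm η hη)
  have hmeas : AEStronglyMeasurable (fun x => fderiv ℝ (fun η => p η x) θ) volume :=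
    aestronglyMeasurable_fderiv_of_eventually
      (by filter_upwards [hΘ.mem_nhds hθ] with η hη using (hpm η hη).aestronglyMeasurable)
      (ae_of_all _ fun x => (hd x).differentiableAt (hΘ.mem_nhds hθ))
  have hder : HasFDerivAt (fun η => ∫ x, p η x) (∫ x, fderiv ℝ (fun η => p η x) θ) θ :=
    hasFDerivAt_integral_of_dominated_of_fderiv_le (𝕜 := ℝ)
      (F' := fun η x => fderiv ℝ (fun η => p η x) η) (inter_mem hU (hΘ.mem_nhds hθ))
      (by filter_upwards [hΘ.mem_nhds hθ] with η hη using (hpm η hη).aestronglyMeasurable)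
      (hone θ hθ).1 hmeas
      (by filter_upwards [hb] with x hx η hη using hx η hη.1) hh
      (ae_of_all _ fun x η hη => ((hd x).differentiableAt (hΘ.mem_nhds hη.2)).hasFDerivAt)
  have hzero : ∫ x, fderiv ℝ (fun η => p η x) θ = 0 := by
    refine hder.unique ((hasFDerivAt_const (1 : ℝ) θ).congr_of_eventuallyEq ?_)
    filter_upwards [hΘ.mem_nhds hθ] with η hη using (hone η hη).2
  have hcancel : ∀ x, (ENNReal.ofReal (p θ x)).toReal •
      ((p θ x)⁻¹ • fderiv ℝ (fun η => p η x) θ) = fderiv ℝ (fun η => p η x) θ := fun x => by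
    have hx := (hp θ hθ).1 x
    rw [ENNReal.toReal_ofReal hx.le, smul_inv_smul₀ hx.ne']
  rw [(hp θ hθ).2]
  constructor
  · rw [integrable_withDensity_iff_integrable_smul' (hpm θ hθ).ennreal_ofReal
      (ae_of_all _ fun x => ENNReal.ofReal_lt_top)]
    simp only [hcancel]
    exact hh.mono' hmeas (by filter_upwards [hb] with x hx using hx θ (mem_of_mem_nhds hU))
  · rw [integral_withDensity_eq_integral_toReal_smul (hpm θ hθ).ennreal_ofReal
      (ae_of_all _ fun x => ENNReal.ofReal_lt_top)]
    simp only [hcancel, hzero]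

/-! ### The log-density ratio along a sample -/

section ChainRule

variable {d m : ℕ} {θ : EuclideanSpace ℝ (Fin m)}
  {p : EuclideanSpace ℝ (Fin m) → EuclideanSpace ℝ (Fin d) → ℝ}
  {q : EuclideanSpace ℝ (Fin d) → ℝ} {x : EuclideanSpace ℝ (Fin m) → EuclideanSpace ℝ (Fin d)}

theorem toDual_score {f : EuclideanSpace ℝ (Fin d) → ℝ} {y : EuclideanSpace ℝ (Fin d)}
    {f' : EuclideanSpace ℝ (Fin d) →L[ℝ] ℝ} (hf : HasFDerivAt f f' y) (h0 : f y ≠ 0) :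
    InnerProductSpace.toDual ℝ _ (score f y) = (f y)⁻¹ • f' := by
  have h := (hf.log h0).hasGradientAt.gradient
  rw [score, h, LinearIsometryEquiv.apply_symm_apply]

/-- The total derivative of the log-density ratio along a sample splits into the relative
parameter derivative of the density at a fixed point and the score difference, pulled back by
the Jacobian of the sample. -/
theorem hasFDerivAt_log_div
    (hp : DifferentiableAt ℝ
      (fun a : EuclideanSpace ℝ (Fin m) × EuclideanSpace ℝ (Fin d) => p a.1 a.2) (θ, x θ))
    (hq : DifferentiableAt ℝ q (x θ)) (hx : DifferentiableAt ℝ x θ)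
    (hp0 : p θ (x θ) ≠ 0) (hq0 : q (x θ) ≠ 0) :
    HasFDerivAt (fun η => Real.log (p η (x η) / q (x η)))
      ((p θ (x θ))⁻¹ • fderiv ℝ (fun η => p η (x θ)) θ + InnerProductSpace.toDual ℝ _
        ((fderiv ℝ x θ).adjoint (score (p θ) (x θ) - score q (x θ)))) θ := by
  set D := fderiv ℝ (fun a : EuclideanSpace ℝ (Fin m) × EuclideanSpace ℝ (Fin d) => p a.1 a.2)
    (θ, x θ) with hD
  have hpath : HasFDerivAt (fun η => p η (x η))
      (D.comp ((ContinuousLinearMap.id ℝ _).prod (fderiv ℝ x θ))) θ :=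
    hp.hasFDerivAt.comp (f := fun η => (η, x η)) θ ((hasFDerivAt_id θ).prodMk hx.hasFDerivAt)
  have hparam : HasFDerivAt (fun η => p η (x θ))
      (D.comp (ContinuousLinearMap.inl ℝ _ _)) θ :=
    hp.hasFDerivAt.comp (f := fun η => (η, x θ)) θ (hasFDerivAt_prodMk_left θ (x θ))
  have hspace : HasFDerivAt (p θ) (D.comp (ContinuousLinearMap.inr ℝ _ _)) (x θ) :=
    hp.hasFDerivAt.comp (f := fun y => (θ, y)) (x θ) (hasFDerivAt_prodMk_right θ (x θ))
  have hqpath : HasFDerivAt (fun η => q (x η)) ((fderiv ℝ q (x θ)).comp (fderiv ℝ x θ)) θ :=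
    hq.hasFDerivAt.comp θ hx.hasFDerivAt
  have hlog := (hpath.log hp0).sub (hqpath.log hq0)
  have hev : (fun η => Real.log (p η (x η) / q (x η))) =ᶠ[𝓝 θ]
      fun η => Real.log (p η (x η)) - Real.log (q (x η)) := by
    filter_upwards [hpath.continuousAt.eventually_ne hp0,
      hqpath.continuousAt.eventually_ne hq0] with η h1 h2 using Real.log_div h1 h2
  refine (hlog.congr_of_eventuallyEq hev).congr_fderiv ?_
  ext v
  have hsp := DFunLike.congr_fun (toDual_score hspace hp0) (fderiv ℝ x θ v)
  have hsq := DFunLike.congr_fun (toDual_score hq.hasFDerivAt hq0) (fderiv ℝ x θ v)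
  rw [InnerProductSpace.toDual_apply_apply] at hsp hsq
  rw [add_apply, InnerProductSpace.toDual_apply_apply,
    ContinuousLinearMap.adjoint_inner_left, inner_sub_left, hsp, hsq, hparam.fderiv]
  have hsplit : D (v, fderiv ℝ x θ v) = D (v, 0) + D (0, fderiv ℝ x θ v) := by
    rw [← map_add]; simp
  simp [hsplit]
  ring

end ChainRule

/-! ### Marginal laws of the diffusion -/

section Marginals

variable {d : ℕ} {Ω Z : Type*} [MeasurableSpace Ω] [MeasurableSpace Z] {P : Measure Ω}
  {pz : Measure Z} {X : ℝ → EuclideanSpace ℝ (Fin d) → Ω → EuclideanSpace ℝ (Fin d)}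

theorem measurable_sample {g : Z → EuclideanSpace ℝ (Fin d)} (hX : Measurable
      (fun a : ℝ × EuclideanSpace ℝ (Fin d) × Ω => X a.1 a.2.1 a.2.2)) (hg : Measurable g) :
    Measurable (fun a : ℝ × Z × Ω => X a.1 (g a.2.1) a.2.2) :=
  hX.comp (measurable_fst.prodMk
    ((hg.comp (measurable_fst.comp measurable_snd)).prodMk (measurable_snd.comp measurable_snd)))

theorem diffusedLaw_map [IsProbabilityMeasure P] [IsProbabilityMeasure pz]
    {g : Z → EuclideanSpace ℝ (Fin d)} (hX : Measurable
      (fun a : ℝ × EuclideanSpace ℝ (Fin d) × Ω => X a.1 a.2.1 a.2.2)) (hg : Measurable g)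
    (t : ℝ) :
    diffusedLaw X P (pz.map g) t = (pz.prod P).map (fun b => X t (g b.1) b.2) := by
  have h := Measure.map_prod_map pz P hg measurable_id
  rw [Measure.map_id] at h
  rw [diffusedLaw, h, Measure.map_map (g := fun a => X t a.1 a.2) (hX.comp measurable_prodMk_left)
    (hg.prodMap measurable_id)]
  rfl

theorem isProbabilityMeasure_diffusedLaw [IsProbabilityMeasure P]
    {μ : Measure (EuclideanSpace ℝ (Fin d))} [IsProbabilityMeasure μ] (hX : Measurable
      (fun a : ℝ × EuclideanSpace ℝ (Fin d) × Ω => X a.1 a.2.1 a.2.2)) (t : ℝ) :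
    IsProbabilityMeasure (diffusedLaw X P μ t) :=
  Measure.isProbabilityMeasure_map (hX.comp measurable_prodMk_left).aemeasurable

end Marginals

/-- The integral Kullback-Leibler divergence as an iterated integral of the log-density ratio
along the samples. As the weight is positive, its finiteness makes the divergence finite for
almost every `t`; for these `t` the inner integral converges. -/
theorem toReal_ikl_map {d : ℕ} {Ω Z : Type*} [MeasurableSpace Ω] [MeasurableSpace Z]
    {P : Measure Ω} [IsProbabilityMeasure P] {pz : Measure Z} [IsProbabilityMeasure pz]
    {X : ℝ → EuclideanSpace ℝ (Fin d) → Ω → EuclideanSpace ℝ (Fin d)}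
    (hX : Measurable (fun a : ℝ × EuclideanSpace ℝ (Fin d) × Ω => X a.1 a.2.1 a.2.2))
    {T : ℝ} {w : ℝ → ℝ} (hwm : Measurable w) (hw : ∀ t ∈ Ioc 0 T, 0 < w t)
    {g : Z → EuclideanSpace ℝ (Fin d)} (hg : Measurable g)
    {q₀ : Measure (EuclideanSpace ℝ (Fin d))} [IsProbabilityMeasure q₀]
    {p q : ℝ → EuclideanSpace ℝ (Fin d) → ℝ}
    (hpm : Measurable (fun a : ℝ × EuclideanSpace ℝ (Fin d) => p a.1 a.2))
    (hqm : Measurable (fun a : ℝ × EuclideanSpace ℝ (Fin d) => q a.1 a.2))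
    (hp : ∀ t ∈ Ioc 0 T, IsPosDensity (diffusedLaw X P (pz.map g) t) (p t))
    (hq : ∀ t ∈ Ioc 0 T, IsPosDensity (diffusedLaw X P q₀ t) (q t))
    (hfin : ikl X P w T (pz.map g) q₀ ≠ ∞) :
    (∀ᵐ t ∂(volume.restrict (Ioc 0 T)), Integrable (fun b : Z × Ω =>
      Real.log (p t (X t (g b.1) b.2) / q t (X t (g b.1) b.2))) (pz.prod P)) ∧
    Integrable (fun t => w t * ∫ b : Z × Ω,
      Real.log (p t (X t (g b.1) b.2) / q t (X t (g b.1) b.2)) ∂(pz.prod P))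
      (volume.restrict (Ioc 0 T)) ∧
    (ikl X P w T (pz.map g) q₀).toReal = ∫ t in Ioc 0 T, w t * ∫ b : Z × Ω,
      Real.log (p t (X t (g b.1) b.2) / q t (X t (g b.1) b.2)) ∂(pz.prod P) := by
  have : IsProbabilityMeasure (pz.map g) := Measure.isProbabilityMeasure_map hg.aemeasurable
  have hμ := isProbabilityMeasure_diffusedLaw (P := P) (μ := pz.map g) hX
  have hν := isProbabilityMeasure_diffusedLaw (P := P) (μ := q₀) hX
  have hpt : ∀ t, Measurable (p t) := fun t => hpm.comp measurable_prodMk_left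
  have hqt : ∀ t, Measurable (q t) := fun t => hqm.comp measurable_prodMk_left
  have hxt : ∀ t, Measurable fun b : Z × Ω => X t (g b.1) b.2 :=
    fun t => (measurable_sample hX hg).comp measurable_prodMk_left
  have hmem : ∀ᵐ t ∂(volume.restrict (Ioc 0 T)), t ∈ Ioc 0 T :=
    ae_restrict_mem measurableSet_Ioc
  have hk : AEMeasurable (fun t => ENNReal.ofReal (w t) * InformationTheory.klDiv
      (diffusedLaw X P (pz.map g) t) (diffusedLaw X P q₀ t)) (volume.restrict (Ioc 0 T)) := by
    have hm : Measurable fun t => ∫⁻ x, ENNReal.ofReal (q t x) *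
        ENNReal.ofReal (InformationTheory.klFun (p t x / q t x)) :=
      Measurable.lintegral_prod_right' (f := fun a : ℝ × EuclideanSpace ℝ (Fin d) =>
        ENNReal.ofReal (q a.1 a.2) *
          ENNReal.ofReal (InformationTheory.klFun (p a.1 a.2 / q a.1 a.2)))
        (hqm.ennreal_ofReal.mul
          (InformationTheory.measurable_klFun.comp (hpm.div hqm)).ennreal_ofReal)
    refine ⟨_, hwm.ennreal_ofReal.mul hm, ?_⟩
    filter_upwards [hmem] with t ht
    rw [(hp t ht).klDiv_eq_lintegral (hq t ht) (hpt t) (hqt t)]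
    rfl
  have hlog : ∀ t, Measurable fun x => Real.log (p t x / q t x) :=
    fun t => ((hpt t).div (hqt t)).log
  have hmap := fun t => diffusedLaw_map (P := P) (pz := pz) hX hg t
  have hlt := ae_lt_top' hk hfin
  have hval : ∀ᵐ t ∂(volume.restrict (Ioc 0 T)), (ENNReal.ofReal (w t) *
      InformationTheory.klDiv (diffusedLaw X P (pz.map g) t) (diffusedLaw X P q₀ t)).toReal =
      w t * ∫ b : Z × Ω,
        Real.log (p t (X t (g b.1) b.2) / q t (X t (g b.1) b.2)) ∂(pz.prod P) := by
    filter_upwards [hmem] with t ht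
    rw [ENNReal.toReal_mul, ENNReal.toReal_ofReal (hw t ht).le,
      InformationTheory.toReal_klDiv_of_measure_eq
        ((hp t ht).absolutelyContinuous (hq t ht) (hpt t) (hqt t)) (by simp),
      integral_congr_ae ((hp t ht).llr_eq (hq t ht) (hpt t) (hqt t)), hmap t,
      integral_map (hxt t).aemeasurable (hlog t).aestronglyMeasurable]
  refine ⟨?_, (integrable_toReal_of_lintegral_ne_top hk hfin).congr hval, ?_⟩
  · filter_upwards [hmem, hlt] with t ht hkt
    have hne : InformationTheory.klDiv (diffusedLaw X P (pz.map g) t)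
        (diffusedLaw X P q₀ t) ≠ ∞ := fun h => by
      rw [h, ENNReal.mul_top (by simpa using hw t ht)] at hkt
      exact lt_irrefl _ hkt
    have hi := (InformationTheory.klDiv_ne_top_iff.1 hne).2
    rw [integrable_congr ((hp t ht).llr_eq (hq t ht) (hpt t) (hqt t)), hmap t] at hi
    exact hi.comp_measurable (hxt t)
  · rw [ikl, ← integral_toReal hk hlt]
    exact integral_congr_ae hval

/-! ### The gradient of the divergence -/

theorem theorem1 {d m : ℕ} {Ω Z : Type*} [MeasurableSpace Ω] [MeasurableSpace Z]
    -- the forward diffusion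
    (P : Measure Ω) [IsProbabilityMeasure P]
    (W : ℝ≥0 → Ω → EuclideanSpace ℝ (Fin d)) (hW : IsWienerProcess W P)
    (F : EuclideanSpace ℝ (Fin d) → ℝ → EuclideanSpace ℝ (Fin d)) (G : ℝ → ℝ)
    (T : ℝ) (hT : 0 < T)
    (X : ℝ → EuclideanSpace ℝ (Fin d) → Ω → EuclideanSpace ℝ (Fin d))
    (hX : IsSDEFlow F G W P T X)
    -- the weighting function
    (w : ℝ → ℝ) (hwm : Measurable w) (hw : ∀ t ∈ Ioc 0 T, 0 < w t)
    -- the generator, and the target distribution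
    (pz : Measure Z) [IsProbabilityMeasure pz]
    (Θ : Set (EuclideanSpace ℝ (Fin m))) (hΘ : IsOpen Θ)
    (g : EuclideanSpace ℝ (Fin m) → Z → EuclideanSpace ℝ (Fin d))
    (hg : ∀ θ ∈ Θ, Measurable (g θ))
    (q₀ : Measure (EuclideanSpace ℝ (Fin d))) [IsProbabilityMeasure q₀]
    (hdiff : ∀ᵐ a ∂((volume.restrict (Ioc 0 T)).prod (pz.prod P)),
      DifferentiableOn ℝ (fun θ => X a.1 (g θ a.2.1) a.2.2) Θ)
    -- the marginal densities
    (p : EuclideanSpace ℝ (Fin m) → ℝ → EuclideanSpace ℝ (Fin d) → ℝ)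
    (q : ℝ → EuclideanSpace ℝ (Fin d) → ℝ)
    (hpm : ∀ θ ∈ Θ, Measurable (fun a : ℝ × EuclideanSpace ℝ (Fin d) => p θ a.1 a.2))
    (hqm : Measurable (fun a : ℝ × EuclideanSpace ℝ (Fin d) => q a.1 a.2))
    (hp : ∀ θ ∈ Θ, ∀ t ∈ Ioc 0 T, IsPosDensity (diffusedLaw X P (pz.map (g θ)) t) (p θ t))
    (hq : ∀ t ∈ Ioc 0 T, IsPosDensity (diffusedLaw X P q₀ t) (q t))
    (hpdiff : ∀ t ∈ Ioc 0 T, DifferentiableOn ℝ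
      (fun a : EuclideanSpace ℝ (Fin m) × EuclideanSpace ℝ (Fin d) => p a.1 t a.2)
      (Θ ×ˢ univ))
    (hqdiff : ∀ t ∈ Ioc 0 T, Differentiable ℝ (q t))
    -- the divergence is finite
    (hfin : ∀ θ ∈ Θ, ikl X P w T (pz.map (g θ)) q₀ ≠ ∞)
    -- local domination of the parameter derivative of the density
    (hdomp : ∀ θ ∈ Θ, ∀ᵐ t ∂(volume.restrict (Ioc 0 T)), ∃ U ∈ 𝓝 θ,
      ∃ h : EuclideanSpace ℝ (Fin d) → ℝ, Integrable h ∧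
        ∀ᵐ x, ∀ θ' ∈ U, ‖fderiv ℝ (fun η => p η t x) θ'‖ ≤ h x)
    -- local domination of the parameter derivative of the log-density ratio along the samples
    (hdom : ∀ θ ∈ Θ, ∃ U ∈ 𝓝 θ, ∃ H : ℝ × Z × Ω → ℝ,
      Integrable (fun a => w a.1 * H a) ((volume.restrict (Ioc 0 T)).prod (pz.prod P)) ∧
      ∀ᵐ a ∂((volume.restrict (Ioc 0 T)).prod (pz.prod P)), ∀ θ' ∈ U,
        ‖fderiv ℝ (fun η => Real.log
          (p η a.1 (X a.1 (g η a.2.1) a.2.2) / q a.1 (X a.1 (g η a.2.1) a.2.2))) θ'‖ ≤ H a) :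
    ∀ θ ∈ Θ,
      (∀ᵐ t ∂(volume.restrict (Ioc 0 T)), Integrable
        (fun b : Z × Ω =>
          (fderiv ℝ (fun η => X t (g η b.1) b.2) θ).adjoint
            (score (p θ t) (X t (g θ b.1) b.2) - score (q t) (X t (g θ b.1) b.2)))
        (pz.prod P)) ∧
      IntervalIntegrable
        (fun t => w t • ∫ b : Z × Ω,
          (fderiv ℝ (fun η => X t (g η b.1) b.2) θ).adjoint
            (score (p θ t) (X t (g θ b.1) b.2) - score (q t) (X t (g θ b.1) b.2))
          ∂(pz.prod P)) volume 0 T ∧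
      HasGradientAt (fun η => (ikl X P w T (pz.map (g η)) q₀).toReal)
        (∫ t in (0 : ℝ)..T, w t • ∫ b : Z × Ω,
          (fderiv ℝ (fun η => X t (g η b.1) b.2) θ).adjoint
            (score (p θ t) (X t (g θ b.1) b.2) - score (q t) (X t (g θ b.1) b.2))
          ∂(pz.prod P)) θ := by
  intro θ hθ
  have hΘθ := hΘ.mem_nhds hθ
  obtain ⟨U, hU, H, hH, hbound⟩ := hdom θ hθ
  have hXm := hX.measurable
  have hmem : ∀ᵐ t ∂(volume.restrict (Ioc 0 T)), t ∈ Ioc 0 T :=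
    ae_restrict_mem measurableSet_Ioc
  have hmem' : ∀ᵐ a ∂((volume.restrict (Ioc 0 T)).prod (pz.prod P)), a.1 ∈ Ioc 0 T :=
    Measure.quasiMeasurePreserving_fst.ae hmem
  have hikl := fun η hη => toReal_ikl_map (P := P) (pz := pz) hXm hwm hw (hg η hη) (hpm η hη) hqm
    (hp η hη) hq (hfin η hη)
  have hpd : ∀ t ∈ Ioc 0 T, ∀ η ∈ Θ, ∀ x, DifferentiableAt ℝ
      (fun a : EuclideanSpace ℝ (Fin m) × EuclideanSpace ℝ (Fin d) => p a.1 t a.2) (η, x) :=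
    fun t ht η hη x => (hpdiff t ht).differentiableAt
      ((hΘ.prod isOpen_univ).mem_nhds ⟨hη, mem_univ x⟩)
  -- The chain rule, wherever the sample is differentiable in the parameter.
  have hchain : ∀ᵐ a ∂((volume.restrict (Ioc 0 T)).prod (pz.prod P)), ∀ η ∈ Θ,
      HasFDerivAt (fun η => Real.log (p η a.1 (X a.1 (g η a.2.1) a.2.2) /
          q a.1 (X a.1 (g η a.2.1) a.2.2)))
        ((p η a.1 (X a.1 (g η a.2.1) a.2.2))⁻¹ •
            fderiv ℝ (fun η' => p η' a.1 (X a.1 (g η a.2.1) a.2.2)) η +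
          InnerProductSpace.toDual ℝ _ ((fderiv ℝ (fun η => X a.1 (g η a.2.1) a.2.2) η).adjoint
            (score (p η a.1) (X a.1 (g η a.2.1) a.2.2) -
              score (q a.1) (X a.1 (g η a.2.1) a.2.2)))) η := by
    filter_upwards [hmem', hdiff] with a ha hda η hη
    exact hasFDerivAt_log_div (p := fun η => p η a.1) (x := fun η => X a.1 (g η a.2.1) a.2.2)
      (hpd a.1 ha η hη _) (hqdiff a.1 ha _) (hda.differentiableAt (hΘ.mem_nhds hη))
      ((hp η hη a.1 ha).1 _).ne' ((hq a.1 ha).1 _).ne'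
  obtain ⟨hint, hder⟩ := hasFDerivAt_integral_mul_integral
    (κ := volume.restrict (Ioc 0 T)) (ρ := pz.prod P)
    (L := fun η (a : ℝ × Z × Ω) => Real.log (p η a.1 (X a.1 (g η a.2.1) a.2.2) /
          q a.1 (X a.1 (g η a.2.1) a.2.2)))
    hΘ hθ hwm (by filter_upwards [hmem] with t ht using hw t ht)
    (fun η hη => by
      have hs := measurable_fst.prodMk (measurable_sample hXm (hg η hη))
      exact (((hpm η hη).comp hs).div (hqm.comp hs)).log.aestronglyMeasurable)
    (by
      filter_upwards [hchain] with a ha η hη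
      exact (ha η hη).differentiableAt.differentiableWithinAt)
    (fun η hη => (hikl η hη).1) (fun η hη => (hikl η hη).2.1) hU hH hbound
  -- For almost every `t`, the term `∂_θ p / p` drops out of the expectation.
  have hterm : ∀ᵐ t ∂(volume.restrict (Ioc 0 T)),
      Integrable (fun b : Z × Ω => (fderiv ℝ (fun η => X t (g η b.1) b.2) θ).adjoint
        (score (p θ t) (X t (g θ b.1) b.2) - score (q t) (X t (g θ b.1) b.2))) (pz.prod P) ∧
      InnerProductSpace.toDual ℝ _ (w t • ∫ b : Z × Ω,
        (fderiv ℝ (fun η => X t (g η b.1) b.2) θ).adjoint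
          (score (p θ t) (X t (g θ b.1) b.2) - score (q t) (X t (g θ b.1) b.2)) ∂(pz.prod P)) =
      ∫ b : Z × Ω, w t • fderiv ℝ (fun η => Real.log (p η t (X t (g η b.1) b.2) /
          q t (X t (g η b.1) b.2))) θ ∂(pz.prod P) := by
    filter_upwards [hmem, hint.prod_right_ae, Measure.ae_ae_of_ae_prod hchain, hdomp θ hθ]
      with t ht hti htc ⟨V, hV, h, hh, hb⟩
    have hti' : Integrable (fun b : Z × Ω => fderiv ℝ (fun η => Real.log
        (p η t (X t (g η b.1) b.2) / q t (X t (g η b.1) b.2))) θ) (pz.prod P) :=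
      (integrable_smul_iff (hw t ht).ne' _).1 hti
    have hxt : Measurable fun b : Z × Ω => X t (g θ b.1) b.2 :=
      (measurable_sample hXm (hg θ hθ)).comp measurable_prodMk_left
    obtain ⟨hs1, hs2⟩ := integral_inv_smul_fderiv_density (μ := fun η =>
        diffusedLaw X P (pz.map (g η)) t) (p := fun η => p η t) hΘ hθ
      (fun η hη => by
        have := Measure.isProbabilityMeasure_map (μ := pz) (hg η hη).aemeasurable
        exact isProbabilityMeasure_diffusedLaw hXm t)
      (fun η hη => (hpm η hη).comp measurable_prodMk_left) (fun η hη => hp η hη t ht)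
      (fun x η hη => ((hpd t ht η hη x).comp η (f := fun η => (η, x))
        (hasFDerivAt_prodMk_left η x).differentiableAt).differentiableWithinAt) hV hh hb
    simp only [diffusedLaw_map hXm (hg θ hθ)] at hs1 hs2
    rw [integral_map hxt.aemeasurable hs1.aestronglyMeasurable] at hs2
    replace hs1 := hs1.comp_measurable hxt
    simp only [Function.comp_def] at hs1
    have hadj : (fun b : Z × Ω => InnerProductSpace.toDual ℝ _
        ((fderiv ℝ (fun η => X t (g η b.1) b.2) θ).adjoint
        (score (p θ t) (X t (g θ b.1) b.2) - score (q t) (X t (g θ b.1) b.2)))) =ᵐ[pz.prod P]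
        fun b => fderiv ℝ (fun η => Real.log
        (p η t (X t (g η b.1) b.2) / q t (X t (g η b.1) b.2))) θ -
        (p θ t (X t (g θ b.1) b.2))⁻¹ •
          fderiv ℝ (fun η => p η t (X t (g θ b.1) b.2)) θ := by
      filter_upwards [htc] with b hbc
      rw [(hbc θ hθ).fderiv, add_sub_cancel_left]
    have hdual : Integrable (fun b : Z × Ω => InnerProductSpace.toDual ℝ _
        ((fderiv ℝ (fun η => X t (g η b.1) b.2) θ).adjoint
        (score (p θ t) (X t (g θ b.1) b.2) - score (q t) (X t (g θ b.1) b.2))))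
        (pz.prod P) := (hti'.sub hs1).congr hadj.symm
    have hadjint := (LinearIsometryEquiv.integrable_comp_iff _).1 hdual
    refine ⟨hadjint, ?_⟩
    rw [integral_smul, map_smulₛₗ, ← integral_toDual hadjint,
      integral_congr_ae hadj, integral_sub hti' hs1, hs2, sub_zero]
    rfl
  have htime : Integrable (fun t => InnerProductSpace.toDual ℝ (EuclideanSpace ℝ (Fin m))
      (w t • ∫ b : Z × Ω, (fderiv ℝ (fun η => X t (g η b.1) b.2) θ).adjoint
        (score (p θ t) (X t (g θ b.1) b.2) - score (q t) (X t (g θ b.1) b.2)) ∂(pz.prod P)))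
      (volume.restrict (Ioc 0 T)) :=
    hint.integral_prod_left.congr (by filter_upwards [hterm] with t ht using ht.2.symm)
  refine ⟨by filter_upwards [hterm] with t ht using ht.1, ?_, ?_⟩
  · rw [intervalIntegrable_iff_integrableOn_Ioc_of_le hT.le]
    exact (LinearIsometryEquiv.integrable_comp_iff _).1 htime
  · rw [hasGradientAt_iff_hasFDerivAt, intervalIntegral.integral_of_le hT.le,
      ← integral_toDual ((LinearIsometryEquiv.integrable_comp_iff _).1 htime),
      integral_congr_ae (by filter_upwards [hterm] with t ht using ht.2),
      ← integral_prod _ hint]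
    refine hder.congr_of_eventuallyEq ?_
    filter_upwards [hΘθ] with η hη using (hikl η hη).2.2
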